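/- Let $k,\rho,C_p,\Delta H^*>0$, $\alpha=\frac{k}{\rho C_p}$, $\beta=\frac{k}{\rho\,\Delta H^*}$, $T_m\in\mathbb R$, $s_0>0$, and let $(T,s)$ be a classical solution of the one-phase Stefan problem $$T_t=\alpha T_{xx}\quad(t>0,\ 0<x<s(t)),\qquad -kT_x(0,t)=q_c(t),\quad T(s(t),t)=T_m,\quad \dot s(t)=-\beta T_x(s(t),t)\quad(t>0),$$ $$s(0)=s_0,\qquad T(x,0)=T_0(x)\quad(0<x\le s_0).$$ Here classical solution means: $s$ is continuous and positive on $[0,\infty)$ and differentiable on $(0,\infty)$; $T$ is continuous on $\{t\ge 0,\ 0\le x\le s(t)\}$; $T_t$ and $T_{xx}$ exist and are continuous on $\{t>0,\ 0<x<s(t)\}$; $T_x$ (one-sided at the end points) exists and is continuous on $\{t>0,\ 0\le x\le s(t)\}$; and the equations hold, where, to admit piecewise continuous fluxes $q_c$, the requirements on $T_x$ at $x=0$ and the flux condition there may be violated at a set of times that is finite in every bounded interval. Suppose that, for some $\Delta\bar T_0>0$, $$T_m\le T_0(x)\le \Delta\bar T_0\Bigl(1-\frac{x}{s_0}\Bigr)+T_m\qquad\text{for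 all }x\in[0,s_0],$$ and that, for some $\bar q>0$, $0\le q_c(t)\le\bar q$ for all $t\ge 0$. Then $$T_m\le T(x,t)\le K\,(s(t)-x)+T_m\qquad\text{for all }x\in(0,s(t))\text{ and all }t\ge 0,$$ where $K=\max\{\bar q/k,\ \Delta\bar T_0/s_0\}$. -/

import Mathlib

open Set

/-- The closed liquid region `{(x, t) : t ≥ 0, 0 ≤ x ≤ s(t)}`. -/
def closedLiquid (s : ℝ → ℝ) : Set (ℝ × ℝ) :=
  {p | 0 ≤ p.2 ∧ 0 ≤ p.1 ∧ p.1 ≤ s p.2}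

/-- The open liquid region `{(x, t) : t > 0, 0 < x < s(t)}`. -/
def openLiquid (s : ℝ → ℝ) : Set (ℝ × ℝ) :=
  {p | 0 < p.2 ∧ 0 < p.1 ∧ p.1 < s p.2}

/-- `{(x, t) : t > 0, 0 ≤ x ≤ s(t)}` without the points `(0, t)`, `t ∈ D`. -/
def lateralLiquid (s : ℝ → ℝ) (D : Set ℝ) : Set (ℝ × ℝ) :=
  {p | 0 < p.2 ∧ 0 ≤ p.1 ∧ p.1 ≤ s p.2 ∧ ¬ (p.1 = 0 ∧ p.2 ∈ D)}

/-- The time derivative `T_t(x, t)`. -/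
noncomputable def tempDt (T : ℝ → ℝ → ℝ) (x t : ℝ) : ℝ :=
  deriv (fun τ => T x τ) t

/-- The space derivative `T_x(x, t)` of the temperature of the liquid `[0, s(t)]`
(one-sided at the end points `x = 0` and `x = s(t)`). -/
noncomputable def tempDx (s : ℝ → ℝ) (T : ℝ → ℝ → ℝ) (x t : ℝ) : ℝ :=
  derivWithin (fun y => T y t) (Icc 0 (s t)) x

/-- The second space derivative `T_xx(x, t)`, used for `0 < x < s(t)`. -/
noncomputable def tempDxx (s : ℝ → ℝ) (T : ℝ → ℝ → ℝ) (x t : ℝ) : ℝ :=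
  deriv (fun y => tempDx s T y t) x

/-- `(T, s)` is a classical solution, for all times `t ≥ 0`, of the one-phase Stefan problem with
heat conductivity `k`, density `ρ`, heat capacity `Cp`, latent heat `ΔH`, melting
temperature `Tm`, initial interface `s₀`, initial temperature `T₀` and boundary heat flux `qc`.
Only the values `T x t` with `t ≥ 0` and `0 ≤ x ≤ s t` matter. -/
structure IsClassicalStefanSolution (k ρ Cp ΔH Tm s₀ : ℝ) (T₀ qc : ℝ → ℝ)
    (T : ℝ → ℝ → ℝ) (s : ℝ → ℝ) : Prop where
  interface_pos : ∀ t, 0 ≤ t → 0 < s t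
  interface_continuousOn : ContinuousOn s (Ici 0)
  temp_continuousOn : ContinuousOn (fun p : ℝ × ℝ => T p.1 p.2) (closedLiquid s)
  temp_differentiableAt_time : ∀ p ∈ openLiquid s, DifferentiableAt ℝ (fun τ => T p.1 τ) p.2
  tempDt_continuousOn : ContinuousOn (fun p : ℝ × ℝ => tempDt T p.1 p.2) (openLiquid s)
  tempDx_differentiableAt : ∀ p ∈ openLiquid s,
    DifferentiableAt ℝ (fun y => tempDx s T y p.2) p.1
  tempDxx_continuousOn : ContinuousOn (fun p : ℝ × ℝ => tempDxx s T p.1 p.2) (openLiquid s)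
  /-- `T_t = α T_xx` with `α = k / (ρ Cp)`. -/
  heat_eq : ∀ p ∈ openLiquid s, tempDt T p.1 p.2 = k / (ρ * Cp) * tempDxx s T p.1 p.2
  /-- `T_x` is continuous up to the lateral boundaries and `-k T_x(0, t) = qc(t)` for `t > 0`.
  To admit a piecewise continuous flux, finitely many times in each bounded interval (the jumps
  of `qc`) may be exempted at `x = 0`; for a continuous flux, `D = ∅`. -/
  flux : ∃ D : Set ℝ, (∀ a : ℝ, (D ∩ Icc 0 a).Finite) ∧
    (∀ p ∈ lateralLiquid s D,
      DifferentiableWithinAt ℝ (fun y => T y p.2) (Icc 0 (s p.2)) p.1) ∧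
    ContinuousOn (fun p : ℝ × ℝ => tempDx s T p.1 p.2) (lateralLiquid s D) ∧
    ∀ t, 0 < t → t ∉ D → -k * tempDx s T 0 t = qc t
  temp_interface : ∀ t, 0 < t → T (s t) t = Tm
  /-- `s' = -β T_x(s(t), t)` with `β = k / (ρ ΔH)`; in particular `s` is `C¹` on `(0, ∞)`. -/
  interface_ode : ∀ t, 0 < t → HasDerivAt s (-(k / (ρ * ΔH)) * tempDx s T (s t) t) t
  interface_init : s 0 = s₀
  temp_init : ∀ x ∈ Ioc 0 s₀, T x 0 = T₀ x

/-! Both bounds are comparison arguments. A supersolution of the heat equation on the liquid region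
that is nonnegative initially and at the interface, with nonpositive x-derivative at the fixed end,
stays nonnegative: a negative minimum could lie neither at the fixed end nor in the interior once
the inequalities are made strict.

For the lower bound this applies to T - Tm. As T is then minimal at the interface, T_x ≤ 0 there, so
s' ≥ 0. This sign makes the moving linear profile K (s(t) - x) + Tm a supersolution: its second
space derivative vanishes and its time derivative is K s'. The choice of K makes it dominate the
initial data and the flux, and both sides equal Tm at the interface.

Exempted flux times are crossed by restarting: the principle never uses the flux condition at the
initial time of a slab. -/

/-- One-sided Fermat: the derivative at a local minimum on `S`, in a direction along which a segment
lies in `S`, is nonnegative. -/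
theorem IsLocalMinOn.mul_hasDerivWithinAt_nonneg {f : ℝ → ℝ} {S : Set ℝ} {a d y : ℝ}
    (h : IsLocalMinOn f S a) (hf : HasDerivWithinAt f d S a) (hy : segment ℝ a (a + y) ⊆ S) :
    0 ≤ y * d := by
  have := h.hasFDerivWithinAt_nonneg hf.hasFDerivWithinAt
    (mem_posTangentConeAt_of_segment_subset hy)
  simpa using this

/-- The second derivative at a local minimum is nonnegative. -/
theorem IsLocalMin.deriv_deriv_nonneg {f : ℝ → ℝ} {x : ℝ} (h : IsLocalMin f x)
    (hc : ContinuousAt f x) : 0 ≤ deriv (deriv f) x := by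
  by_contra! hneg
  -- A negative second derivative would make x a local maximum too, so f would be locally constant.
  have hmax := isLocalMax_of_deriv_deriv_neg hneg h.deriv_eq_zero hc
  have hconst : f =ᶠ[nhds x] fun _ => f x := by
    filter_upwards [h, hmax] with y h₁ h₂ using le_antisymm h₂ h₁
  have := hconst.deriv.deriv_eq
  simp at this
  linarith

/-- The scaling (l, t) ↦ (l s(t), t) maps a rectangle continuously onto the region. -/
theorem isCompact_liquid {s : ℝ → ℝ} {a b : ℝ} (hs : ContinuousOn s (Icc a b))
    (hpos : ∀ t ∈ Icc a b, 0 < s t) :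
    IsCompact {p : ℝ × ℝ | p.2 ∈ Icc a b ∧ p.1 ∈ Icc 0 (s p.2)} := by
  have himg : {p : ℝ × ℝ | p.2 ∈ Icc a b ∧ p.1 ∈ Icc 0 (s p.2)} =
      (fun p : ℝ × ℝ => (p.1 * s p.2, p.2)) '' (Icc 0 1 ×ˢ Icc a b) := by
    ext ⟨x, t⟩
    constructor
    · rintro ⟨ht, hx⟩
      have h0 := hpos t ht
      refine ⟨(x / s t, t), ⟨⟨div_nonneg hx.1 h0.le, (div_le_one h0).2 hx.2⟩, ht⟩, ?_⟩
      simp [h0.ne']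
    · rintro ⟨⟨l, τ⟩, ⟨hl, hτ⟩, h⟩
      simp only [Prod.mk.injEq] at h
      obtain ⟨rfl, rfl⟩ := h
      have h0 := hpos τ hτ
      exact ⟨hτ, mul_nonneg hl.1 h0.le, mul_le_of_le_one_left h0.le hl.2⟩
  rw [himg]
  refine (isCompact_Icc.prod isCompact_Icc).image_of_continuousOn ?_
  refine ContinuousOn.prodMk (continuousOn_fst.mul ?_) continuousOn_snd
  exact hs.comp continuousOn_snd fun p hp => hp.2

/-! ### Weak minimum principle below a moving boundary -/

/-- Weak minimum principle for strict supersolutions of the heat equation on a time slab, with a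
strict Neumann condition at `x = 0`. -/
theorem nonneg_of_strict_supersolution {α a b : ℝ} (hα : 0 ≤ α) {s : ℝ → ℝ} {w : ℝ → ℝ → ℝ}
    (hpos : ∀ t ∈ Icc a b, 0 < s t) (hs : ContinuousOn s (Icc a b))
    (hw : ContinuousOn (fun p : ℝ × ℝ => w p.1 p.2)
      {p : ℝ × ℝ | p.2 ∈ Icc a b ∧ p.1 ∈ Icc 0 (s p.2)})
    (ht : ∀ t ∈ Ioc a b, ∀ x ∈ Ioo 0 (s t), DifferentiableAt ℝ (fun τ => w x τ) t)
    (hx : ∀ t ∈ Ioc a b, ∀ x ∈ Ioo 0 (s t), DifferentiableAt ℝ (fun y => w y t) x)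
    (hsup : ∀ t ∈ Ioc a b, ∀ x ∈ Ioo 0 (s t),
      α * deriv (deriv fun y => w y t) x < deriv (fun τ => w x τ) t)
    (hflux : ∀ t ∈ Ioc a b, ∃ d < 0, HasDerivWithinAt (fun y => w y t) d (Icc 0 (s t)) 0)
    (hlat : ∀ t ∈ Ioc a b, 0 ≤ w (s t) t) (hinit : ∀ x ∈ Icc 0 (s a), 0 ≤ w x a) :
    ∀ t ∈ Icc a b, ∀ x ∈ Icc 0 (s t), 0 ≤ w x t := by
  intro t₁ ht₁ x₁ hx₁
  by_contra! hneg
  obtain ⟨⟨x, t⟩, ⟨htm, hxm⟩, hmin⟩ :=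
    (isCompact_liquid hs hpos).exists_isMinOn ⟨(x₁, t₁), ht₁, hx₁⟩ hw
  dsimp only at htm hxm
  have hle : ∀ τ ∈ Icc a b, ∀ y ∈ Icc 0 (s τ), w x t ≤ w y τ :=
    fun τ hτ y hy => hmin (show (y, τ) ∈ _ from ⟨hτ, hy⟩)
  have hwneg : w x t < 0 := (hle t₁ ht₁ x₁ hx₁).trans_lt hneg
  have hta : a < t := by
    refine lt_of_le_of_ne htm.1 ?_
    rintro rfl
    exact (hinit x hxm).not_gt hwneg
  have htm' : t ∈ Ioc a b := ⟨hta, htm.2⟩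
  have hxs : x < s t := by
    refine lt_of_le_of_ne hxm.2 ?_
    rintro rfl
    exact (hlat t htm').not_gt hwneg
  rcases hxm.1.eq_or_lt with rfl | hx0
  · obtain ⟨d, hd, hder⟩ := hflux t htm'
    have hmin' : IsLocalMinOn (fun y => w y t) (Icc 0 (s t)) 0 :=
      Filter.eventually_of_mem self_mem_nhdsWithin fun y hy => hle t htm y hy
    have := hmin'.mul_hasDerivWithinAt_nonneg hder (y := s t)
      (by rw [zero_add, segment_eq_Icc hxs.le])
    nlinarith
  · have hxx : 0 ≤ deriv (deriv fun y => w y t) x := by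
      refine IsLocalMin.deriv_deriv_nonneg ?_ (hx t htm' x ⟨hx0, hxs⟩).continuousAt
      filter_upwards [Icc_mem_nhds hx0 hxs] with y hy using hle t htm y hy
    have hdt := (ht t htm' x ⟨hx0, hxs⟩).hasDerivAt
    -- Only earlier times are compared, since t may equal b. By continuity of s the point x stays in
    -- the liquid just before t.
    have hmin' : IsLocalMinOn (fun τ => w x τ) (Icc a t) t := by
      have hst : ContinuousWithinAt s (Icc a t) t :=
        (hs t htm).mono (Icc_subset_Icc_right htm.2)
      filter_upwards [hst.eventually (lt_mem_nhds hxs), self_mem_nhdsWithin] with τ hτ hτ'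
      exact hle τ ⟨hτ'.1, hτ'.2.trans htm.2⟩ x ⟨hx0.le, hτ.le⟩
    have := hmin'.mul_hasDerivWithinAt_nonneg hdt.hasDerivWithinAt (y := a - t)
      (by rw [add_sub_cancel, segment_symm, segment_eq_Icc hta.le])
    have := hsup t htm' x ⟨hx0, hxs⟩
    have := mul_nonneg hα hxx
    nlinarith

/-- Weak minimum principle for supersolutions of the heat equation on a time slab. -/
theorem nonneg_of_supersolution_slab {α a b : ℝ} (hα : 0 ≤ α) (hab : a ≤ b) {s : ℝ → ℝ} {v : ℝ → ℝ → ℝ}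
    (hpos : ∀ t ∈ Icc a b, 0 < s t) (hs : ContinuousOn s (Icc a b))
    (hv : ContinuousOn (fun p : ℝ × ℝ => v p.1 p.2)
      {p : ℝ × ℝ | p.2 ∈ Icc a b ∧ p.1 ∈ Icc 0 (s p.2)})
    (ht : ∀ t ∈ Ioc a b, ∀ x ∈ Ioo 0 (s t), DifferentiableAt ℝ (fun τ => v x τ) t)
    (hx : ∀ t ∈ Ioc a b, ∀ x ∈ Ioo 0 (s t), DifferentiableAt ℝ (fun y => v y t) x)
    (hsup : ∀ t ∈ Ioc a b, ∀ x ∈ Ioo 0 (s t),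
      α * deriv (deriv fun y => v y t) x ≤ deriv (fun τ => v x τ) t)
    (hflux : ∀ t ∈ Ioc a b, ∃ d ≤ 0, HasDerivWithinAt (fun y => v y t) d (Icc 0 (s t)) 0)
    (hlat : ∀ t ∈ Ioc a b, 0 ≤ v (s t) t) (hinit : ∀ x ∈ Icc 0 (s a), 0 ≤ v x a) :
    ∀ t ∈ Icc a b, ∀ x ∈ Icc 0 (s t), 0 ≤ v x t := by
  obtain ⟨M, hM⟩ := (isCompact_Icc.image_of_continuousOn hs).bddAbove
  have hM' : ∀ t ∈ Icc a b, s t ≤ M := fun t ht => hM (mem_image_of_mem s ht)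
  -- The added term is nonnegative on the slab, raises the time derivative by ε, lowers the space
  -- derivative by ε and leaves the second one unchanged, so both inequalities become strict.
  have key : ∀ ε > 0, ∀ t ∈ Icc a b, ∀ x ∈ Icc 0 (s t),
      0 ≤ v x t + ε * ((t - a) + (M - x)) := by
    intro ε hε
    have hdx : ∀ t x d S, HasDerivWithinAt (fun y => v y t) d S x →
        HasDerivWithinAt (fun y => v y t + ε * ((t - a) + (M - y))) (d - ε) S x := by
      intro t x d S h
      have := h.add ((((hasDerivWithinAt_id x S).const_sub M).const_add (t - a)).const_mul ε)
      exact this.congr_deriv (by ring)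
    have hdx' : ∀ t x, DifferentiableAt ℝ (fun y => v y t) x →
        HasDerivAt (fun y => v y t + ε * ((t - a) + (M - y)))
          (deriv (fun y => v y t) x - ε) x := by
      intro t x h
      rw [← hasDerivWithinAt_univ]
      exact hdx t x _ _ h.hasDerivAt.hasDerivWithinAt
    have hdt : ∀ t x, DifferentiableAt ℝ (fun τ => v x τ) t →
        HasDerivAt (fun τ => v x τ + ε * ((τ - a) + (M - x)))
          (deriv (fun τ => v x τ) t + ε) t := by
      intro t x h
      have := h.hasDerivAt.add ((((hasDerivAt_id t).sub_const a).add_const (M - x)).const_mul ε)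
      exact this.congr_deriv (by ring)
    refine nonneg_of_strict_supersolution (α := α) hα hpos hs ?_ ?_ ?_ ?_ ?_ ?_ ?_
    · exact hv.add (Continuous.continuousOn (by fun_prop))
    · exact fun t htm x hxm => (hdt t x (ht t htm x hxm)).differentiableAt
    · exact fun t htm x hxm => (hdx' t x (hx t htm x hxm)).differentiableAt
    · intro t htm x hxm
      have h2 : deriv (fun y => v y t + ε * ((t - a) + (M - y))) =ᶠ[nhds x]
          fun y => deriv (fun y => v y t) y - ε := by
        filter_upwards [Ioo_mem_nhds hxm.1 hxm.2] with y hy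
        exact (hdx' t y (hx t htm y hy)).deriv
      rw [h2.deriv_eq, deriv_sub_const, (hdt t x (ht t htm x hxm)).deriv]
      linarith [hsup t htm x hxm]
    · intro t htm
      obtain ⟨d, hd, h⟩ := hflux t htm
      exact ⟨d - ε, by linarith, hdx t 0 d _ h⟩
    · intro t htm
      have := hM' t (Ioc_subset_Icc_self htm)
      have := hlat t htm
      have : 0 ≤ ε * ((t - a) + (M - s t)) :=
        mul_nonneg hε.le (by linarith [htm.1])
      linarith
    · intro x hxm
      have := hM' a ⟨le_rfl, hab⟩
      have : 0 ≤ ε * ((a - a) + (M - x)) :=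
        mul_nonneg hε.le (by linarith [hxm.2])
      linarith [hinit x hxm]
  intro t htm x hxm
  have hlim : Filter.Tendsto (fun ε : ℝ => v x t + ε * ((t - a) + (M - x)))
      (nhdsWithin 0 (Ioi 0)) (nhds (v x t)) := by
    have : Continuous fun ε : ℝ => v x t + ε * ((t - a) + (M - x)) := by fun_prop
    simpa using (this.tendsto 0).mono_left nhdsWithin_le_nhds
  exact ge_of_tendsto hlim (Filter.eventually_of_mem self_mem_nhdsWithin
    fun ε hε => key ε hε t htm x hxm)

/-- Weak minimum principle for supersolutions of the heat equation on the liquid region, where the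
Neumann condition at `x = 0` may fail at a locally finite set of times. -/
theorem nonneg_of_supersolution {α : ℝ} (hα : 0 ≤ α) {s : ℝ → ℝ} {v : ℝ → ℝ → ℝ} {D : Set ℝ}
    (hpos : ∀ t, 0 ≤ t → 0 < s t) (hs : ContinuousOn s (Ici 0))
    (hv : ContinuousOn (fun p : ℝ × ℝ => v p.1 p.2) (closedLiquid s))
    (ht : ∀ p ∈ openLiquid s, DifferentiableAt ℝ (fun τ => v p.1 τ) p.2)
    (hx : ∀ p ∈ openLiquid s, DifferentiableAt ℝ (fun y => v y p.2) p.1)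
    (hsup : ∀ p ∈ openLiquid s,
      α * deriv (deriv fun y => v y p.2) p.1 ≤ deriv (fun τ => v p.1 τ) p.2)
    (hD : ∀ a : ℝ, (D ∩ Icc 0 a).Finite)
    (hflux : ∀ t, 0 < t → t ∉ D →
      ∃ d ≤ 0, HasDerivWithinAt (fun y => v y t) d (Icc 0 (s t)) 0)
    (hlat : ∀ t, 0 < t → 0 ≤ v (s t) t) (hinit : ∀ x ∈ Icc 0 (s 0), 0 ≤ v x 0) :
    ∀ t, 0 ≤ t → ∀ x ∈ Icc 0 (s t), 0 ≤ v x t := by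
  intro b hb
  -- Continuous induction on time: the good times form a closed set, and each one before b is
  -- followed by good times arbitrarily close to it.
  suffices h : Icc 0 b ⊆ {t | ∀ x ∈ Icc 0 (s t), 0 ≤ v x t} from h ⟨hb, le_rfl⟩
  refine IsClosed.Icc_subset_of_forall_exists_gt ?_ hinit ?_
  · have hset : {t | ∀ x ∈ Icc 0 (s t), 0 ≤ v x t} ∩ Icc 0 b =
        ⋂ l : Icc (0 : ℝ) 1, Icc 0 b ∩ (fun t => v (l * s t) t) ⁻¹' Ici 0 := by
      ext t
      simp only [mem_inter_iff, mem_ofPred_eq, mem_iInter, mem_preimage, mem_Ici]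
      constructor
      · rintro ⟨h, htm⟩ ⟨l, hl⟩
        have h0 := hpos t htm.1
        exact ⟨htm, h _ ⟨mul_nonneg hl.1 h0.le, mul_le_of_le_one_left h0.le hl.2⟩⟩
      · intro h
        have htm := (h ⟨0, by simp⟩).1
        have h0 := hpos t htm.1
        refine ⟨fun x hxm => ?_, htm⟩
        have := (h ⟨x / s t, div_nonneg hxm.1 h0.le, (div_le_one h0).2 hxm.2⟩).2
        simpa [h0.ne'] using this
    rw [hset]
    refine isClosed_iInter fun l => ContinuousOn.preimage_isClosed_of_isClosed ?_ isClosed_Icc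
      isClosed_Ici
    refine hv.comp (f := fun t => ((l : ℝ) * s t, t)) (ContinuousOn.prodMk
      (continuousOn_const.mul (hs.mono fun t h => h.1)) continuousOn_id) fun t htm => ?_
    have h0 := hpos t htm.1
    exact ⟨htm.1, mul_nonneg l.2.1 h0.le, mul_le_of_le_one_left h0.le l.2.2⟩
  · rintro t ⟨hgood, ht0, -⟩ y hy
    -- The time t itself may be exempted, being the initial time of the next slab; local finiteness
    -- keeps a short interval after it free of exempted times.
    have hfin : ((D ∩ Icc 0 y) \ {t}).Finite := (hD y).subset sdiff_subset
    have hev : ∀ᶠ c in nhdsWithin t (Ioi t), Ioc t c ∩ ((D ∩ Icc 0 y) \ {t}) = ∅ := by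
      have : ((D ∩ Icc 0 y) \ {t})ᶜ ∈ nhds t := hfin.isClosed.isOpen_compl.mem_nhds (by simp)
      obtain ⟨u, hu, hsub⟩ := exists_Ico_subset_of_mem_nhds this ⟨t + 1, by simp⟩
      filter_upwards [Ioo_mem_nhdsGT hu] with c hc
      ext z
      simp only [mem_inter_iff, mem_empty_iff_false, iff_false, not_and]
      intro hz
      exact hsub ⟨hz.1.le, hz.2.trans_lt hc.2⟩
    obtain ⟨c, hc, htc, hcy⟩ := (hev.and (Ioc_mem_nhdsGT (show t < y from hy))).exists
    refine ⟨c, ?_, htc, hcy⟩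
    refine nonneg_of_supersolution_slab (α := α) (a := t) (b := c) hα htc.le
      (fun τ h => hpos τ (ht0.trans h.1)) (hs.mono fun τ h => ht0.trans h.1)
      (hv.mono fun p h => ⟨ht0.trans h.1.1, h.2⟩)
      (fun τ h x hxm => ht (x, τ) ⟨ht0.trans_lt h.1, hxm⟩)
      (fun τ h x hxm => hx (x, τ) ⟨ht0.trans_lt h.1, hxm⟩)
      (fun τ h x hxm => hsup (x, τ) ⟨ht0.trans_lt h.1, hxm⟩)
      (fun τ h => hflux τ (ht0.trans_lt h.1) fun hτ => ?_)
      (fun τ h => hlat τ (ht0.trans_lt h.1)) hgood c ⟨htc.le, le_rfl⟩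
    have : τ ∈ Ioc t c ∩ ((D ∩ Icc 0 y) \ {t}) :=
      ⟨h, ⟨hτ, ht0.trans h.1.le, h.2.trans hcy⟩, h.1.ne'⟩
    rw [hc] at this
    exact this

/-! ### Comparison for the Stefan problem -/

namespace IsClassicalStefanSolution

variable {k ρ Cp ΔH Tm s₀ : ℝ} {T₀ qc : ℝ → ℝ} {T : ℝ → ℝ → ℝ} {s : ℝ → ℝ}

theorem temp_differentiableAt_space
    (h : IsClassicalStefanSolution k ρ Cp ΔH Tm s₀ T₀ qc T s) {p : ℝ × ℝ} (hp : p ∈ openLiquid s) :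
    DifferentiableAt ℝ (fun y => T y p.2) p.1 := by
  obtain ⟨D, -, hd, -⟩ := h.flux
  exact (hd p ⟨hp.1, hp.2.1.le, hp.2.2.le, fun h => hp.2.1.ne' h.1⟩).differentiableAt
    (Icc_mem_nhds hp.2.1 hp.2.2)

theorem tempDx_eventuallyEq {p : ℝ × ℝ} (hp : p ∈ openLiquid s) :
    (fun y => tempDx s T y p.2) =ᶠ[nhds p.1] deriv fun y => T y p.2 := by
  filter_upwards [Ioo_mem_nhds hp.2.1 hp.2.2] with y hy
  exact derivWithin_of_mem_nhds (Icc_mem_nhds hy.1 hy.2)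

theorem heat_eq_deriv (h : IsClassicalStefanSolution k ρ Cp ΔH Tm s₀ T₀ qc T s) {p : ℝ × ℝ}
    (hp : p ∈ openLiquid s) :
    deriv (fun τ => T p.1 τ) p.2 = k / (ρ * Cp) * deriv (deriv fun y => T y p.2) p.1 := by
  rw [← (tempDx_eventuallyEq hp).deriv_eq]
  exact h.heat_eq p hp

theorem hasDerivWithinAt_interface (h : IsClassicalStefanSolution k ρ Cp ΔH Tm s₀ T₀ qc T s)
    {t : ℝ} (ht : 0 < t) :
    HasDerivWithinAt (fun y => T y t) (tempDx s T (s t) t) (Icc 0 (s t)) (s t) := by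
  obtain ⟨D, -, hd, -⟩ := h.flux
  have h0 := h.interface_pos t ht.le
  exact (hd (s t, t) ⟨ht, h0.le, le_rfl, fun h => h0.ne' h.1⟩).hasDerivWithinAt

theorem exists_hasDerivWithinAt_flux (hk : k ≠ 0)
    (h : IsClassicalStefanSolution k ρ Cp ΔH Tm s₀ T₀ qc T s) :
    ∃ D : Set ℝ, (∀ a : ℝ, (D ∩ Icc 0 a).Finite) ∧ ∀ t, 0 < t → t ∉ D →
      HasDerivWithinAt (fun y => T y t) (-(qc t / k)) (Icc 0 (s t)) 0 := by
  obtain ⟨D, hD, hd, -, hq⟩ := h.flux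
  refine ⟨D, hD, fun t ht htD => ?_⟩
  have := (hd (0, t) ⟨ht, le_rfl, (h.interface_pos t ht.le).le, fun h => htD h.2⟩).hasDerivWithinAt
  have hval : -(qc t / k) = tempDx s T 0 t := by
    rw [← hq t ht htD]
    field_simp
  rw [hval]
  exact this

/-- The initial temperature is prescribed only for x > 0; this continuity carries bounds over to x =
0. -/
theorem temp_init_continuousOn (h : IsClassicalStefanSolution k ρ Cp ΔH Tm s₀ T₀ qc T s) :
    ContinuousOn (fun x => T x 0) (closure (Ioc 0 (s 0))) := by
  rw [closure_Ioc (h.interface_pos 0 le_rfl).ne]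
  exact h.temp_continuousOn.comp (f := fun x : ℝ => (x, (0 : ℝ)))
    (Continuous.continuousOn (by fun_prop)) fun x hx => ⟨le_rfl, hx⟩

/-- The temperature stays above the melting temperature. -/
theorem melting_le_temp (hk : 0 < k) (hρ : 0 < ρ) (hCp : 0 < Cp)
    (h : IsClassicalStefanSolution k ρ Cp ΔH Tm s₀ T₀ qc T s)
    (hT₀ : ∀ x ∈ Ioc 0 s₀, Tm ≤ T₀ x) (hqc : ∀ t, 0 ≤ t → 0 ≤ qc t) :
    ∀ t, 0 ≤ t → ∀ x ∈ Icc 0 (s t), Tm ≤ T x t := by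
  obtain ⟨D, hD, hflux⟩ := h.exists_hasDerivWithinAt_flux hk.ne'
  have key := nonneg_of_supersolution (α := k / (ρ * Cp)) (by positivity)
    (v := fun x t => T x t - Tm) h.interface_pos h.interface_continuousOn
    (h.temp_continuousOn.sub continuousOn_const)
    (fun p hp => (h.temp_differentiableAt_time p hp).sub_const Tm)
    (fun p hp => (h.temp_differentiableAt_space hp).sub_const Tm) ?_ hD
    (fun t ht htD => ⟨-(qc t / k), neg_nonpos.2 (div_nonneg (hqc t ht.le) hk.le),
      (hflux t ht htD).sub_const Tm⟩)
    (fun t ht => (sub_eq_zero.2 (h.temp_interface t ht)).ge) ?_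
  · exact fun t ht x hx => sub_nonneg.1 (key t ht x hx)
  · intro p hp
    simp only [deriv_sub_const_fun]
    exact (h.heat_eq_deriv hp).ge
  · intro x hx
    rw [← closure_Ioc (h.interface_pos 0 le_rfl).ne] at hx
    refine sub_nonneg.2 (le_on_closure (fun y hy => ?_) continuousOn_const
      h.temp_init_continuousOn hx)
    rw [h.interface_init] at hy
    exact (hT₀ y hy).trans_eq (h.temp_init y hy).symm

/-- The interface speed is nonnegative as long as the liquid is not undercooled. -/
theorem tempDx_interface_nonpos (h : IsClassicalStefanSolution k ρ Cp ΔH Tm s₀ T₀ qc T s)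
    {t : ℝ} (ht : 0 < t) (hT : ∀ x ∈ Icc 0 (s t), Tm ≤ T x t) : tempDx s T (s t) t ≤ 0 := by
  have h0 := h.interface_pos t ht.le
  have hmin : IsLocalMinOn (fun y => T y t) (Icc 0 (s t)) (s t) :=
    Filter.eventually_of_mem self_mem_nhdsWithin fun y hy =>
      (h.temp_interface t ht).trans_le (hT y hy)
  have := hmin.mul_hasDerivWithinAt_nonneg (h.hasDerivWithinAt_interface ht) (y := -s t)
    (by rw [add_neg_cancel, segment_symm, segment_eq_Icc h0.le])
  nlinarith

/-- Upper bound of the temperature by a profile that is linear in space. -/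
theorem temp_le_linear {K : ℝ} (hk : 0 < k) (hρ : 0 < ρ) (hCp : 0 < Cp) (hΔH : 0 < ΔH)
    (hK : 0 ≤ K) (h : IsClassicalStefanSolution k ρ Cp ΔH Tm s₀ T₀ qc T s)
    (hT₀ : ∀ x ∈ Ioc 0 s₀, T₀ x ≤ K * (s₀ - x) + Tm) (hqc : ∀ t, 0 ≤ t → qc t / k ≤ K)
    (hT : ∀ t, 0 ≤ t → ∀ x ∈ Icc 0 (s t), Tm ≤ T x t) :
    ∀ t, 0 ≤ t → ∀ x ∈ Icc 0 (s t), T x t ≤ K * (s t - x) + Tm := by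
  obtain ⟨D, hD, hflux⟩ := h.exists_hasDerivWithinAt_flux hk.ne'
  have hdx : ∀ p ∈ openLiquid s, HasDerivAt (fun y => K * (s p.2 - y) + Tm - T y p.2)
      (-K - deriv (fun y => T y p.2) p.1) p.1 := fun p hp =>
    ((((hasDerivAt_id p.1).const_sub (s p.2)).const_mul K).add_const Tm |>.sub
      (h.temp_differentiableAt_space hp).hasDerivAt).congr_deriv (by ring)
  have hdt : ∀ p ∈ openLiquid s, HasDerivAt (fun τ => K * (s τ - p.1) + Tm - T p.1 τ)
      (K * (-(k / (ρ * ΔH)) * tempDx s T (s p.2) p.2) - deriv (fun τ => T p.1 τ) p.2) p.2 :=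
    fun p hp => (((h.interface_ode p.2 hp.1).sub_const p.1).const_mul K).add_const Tm |>.sub
      (h.temp_differentiableAt_time p hp).hasDerivAt
  have key := nonneg_of_supersolution (α := k / (ρ * Cp)) (by positivity)
    (v := fun x t => K * (s t - x) + Tm - T x t) h.interface_pos h.interface_continuousOn ?_
    (fun p hp => (hdt p hp).differentiableAt) (fun p hp => (hdx p hp).differentiableAt) ?_ hD
    (fun t ht htD => ⟨qc t / k - K, sub_nonpos.2 (hqc t ht.le), ?_⟩)
    (fun t ht => by simp [h.temp_interface t ht]) ?_
  · exact fun t ht x hx => sub_nonneg.1 (key t ht x hx)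
  · refine ContinuousOn.sub (((ContinuousOn.sub ?_ continuousOn_fst).const_mul K).add
      continuousOn_const) h.temp_continuousOn
    exact h.interface_continuousOn.comp continuousOn_snd fun p hp => hp.1
  · intro p hp
    have h2 : deriv (fun y => K * (s p.2 - y) + Tm - T y p.2) =ᶠ[nhds p.1]
        fun y => -K - deriv (fun y => T y p.2) y := by
      filter_upwards [Ioo_mem_nhds hp.2.1 hp.2.2] with y hy
      exact (hdx (y, p.2) ⟨hp.1, hy⟩).deriv
    rw [h2.deriv_eq, deriv_const_sub, (hdt p hp).deriv, h.heat_eq_deriv hp]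
    -- After the heat equation cancels the terms in T, what remains to show is K s'(t) ≥ 0.
    have hneg := h.tempDx_interface_nonpos hp.1 (hT p.2 hp.1.le)
    have hβ : 0 < k / (ρ * ΔH) := by positivity
    have := mul_nonneg hK (mul_nonneg_of_nonpos_of_nonpos (neg_nonpos.2 hβ.le) hneg)
    linarith
  · exact ((((hasDerivWithinAt_id 0 _).const_sub (s t)).const_mul K).add_const Tm |>.sub
      (hflux t ht htD)).congr_deriv (by ring)
  · intro x hx
    rw [← closure_Ioc (h.interface_pos 0 le_rfl).ne] at hx
    refine sub_nonneg.2 (le_on_closure (g := fun y => K * (s 0 - y) + Tm) (fun y hy => ?_)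
      h.temp_init_continuousOn (Continuous.continuousOn (by fun_prop)) hx)
    rw [h.interface_init] at hy ⊢
    exact (h.temp_init y hy).trans_le (hT₀ y hy)

end IsClassicalStefanSolution

theorem lemma3 (k ρ Cp ΔH Tm s₀ ΔT₀ qbar : ℝ)
    (hk : 0 < k) (hρ : 0 < ρ) (hCp : 0 < Cp) (hΔH : 0 < ΔH) (hs₀ : 0 < s₀)
    (hΔT₀ : 0 < ΔT₀) (hqbar : 0 < qbar)
    (T₀ qc : ℝ → ℝ) (T : ℝ → ℝ → ℝ) (s : ℝ → ℝ)
    (hsol : IsClassicalStefanSolution k ρ Cp ΔH Tm s₀ T₀ qc T s)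
    (hT₀ : ∀ x ∈ Icc 0 s₀, Tm ≤ T₀ x ∧ T₀ x ≤ ΔT₀ * (1 - x / s₀) + Tm)
    (hqc : ∀ t, 0 ≤ t → 0 ≤ qc t ∧ qc t ≤ qbar) :
    ∀ t, 0 ≤ t → ∀ x ∈ Ioo 0 (s t),
      Tm ≤ T x t ∧ T x t ≤ max (qbar / k) (ΔT₀ / s₀) * (s t - x) + Tm := by
  have hlow := hsol.melting_le_temp hk hρ hCp
    (fun x hx => (hT₀ x (Ioc_subset_Icc_self hx)).1) fun t ht => (hqc t ht).1
  have hup := hsol.temp_le_linear (K := max (qbar / k) (ΔT₀ / s₀)) hk hρ hCp hΔH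
    (le_max_of_le_left (by positivity)) (fun x hx => ?_)
    (fun t ht => le_max_of_le_left (div_le_div_of_nonneg_right (hqc t ht).2 hk.le)) hlow
  · exact fun t ht x hx =>
      ⟨hlow t ht x (Ioo_subset_Icc_self hx), hup t ht x (Ioo_subset_Icc_self hx)⟩
  · have hlin : ΔT₀ * (1 - x / s₀) = ΔT₀ / s₀ * (s₀ - x) := by field_simp
    have hmax : ΔT₀ / s₀ * (s₀ - x) ≤ max (qbar / k) (ΔT₀ / s₀) * (s₀ - x) :=
      mul_le_mul_of_nonneg_right (le_max_right _ _) (sub_nonneg.2 hx.2)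
    have := (hT₀ x (Ioc_subset_Icc_self hx)).2
    linarith
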